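/- Let $n,s$ be integers with $0<s<n$, and let $C\in\mathbb{R}^{n\times n}$ be symmetric positive semidefinite with $\operatorname{rank}(C)\ge s$ (so that $C,s$ define an instance of the maximum-entropy sampling problem $\mathrm{MESP}(C,s)$: $\max\{\log\det C_{S,S} : S\subseteq\{1,\dots,n\},\ |S|=s\}$). Throughout, $\log 0:=-\infty$. For integers $0<s\le k$ and $\omega\in\mathbb{R}^k$ with $\omega_1\ge\cdots\ge\omega_k\ge 0$, and with $\omega_0:=+\infty$, there is a unique integer $\hat\imath$ with $0\le\hat\imath<s$ and $\omega_{\hat\imath}>\frac{1}{s-\hat\imath}\sum_{\ell=\hat\imath+1}^k\omega_\ell\ge\omega_{\hat\imath+1}$; put $$\phi_s(\omega):=\sum_{\ell=1}^{\hat\imath}\log\omega_\ell+(s-\hat\imath)\log\Big(\frac{1}{s-\hat\imath}\sum_{\ell=\hat\imath+1}^{k}\omega_\ell\Big).$$ For a symmetric positive-semidefinite $k\times k$ matrix $X$ put $\Gamma_s(X):=\phi_s(\lambda(X))$, where $\lambda(X)$ is the vector of eigenvalues of $X$ (with multiplicity) in nonincreasing order. For a factorization $C=FF^\top$ with $F\in\mathbb{R}^{n\times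 p}$, $\operatorname{rank}(C)\le p\le n$, the factorization (DDFact, $\Gamma$-function) bound for $\mathrm{MESP}(C,s)$ is $$z_\Gamma(C,s;F):=\max\Big\{\Gamma_s\big(F^\top\operatorname{Diag}(x)F\big)\ :\ \textstyle\sum_{i=1}^n x_i=s,\ x\in[0,1]^n\Big\}.$$ Let $\delta_\ell(C)$ denote the $\ell$-th greatest diagonal entry of $C$. Theorem. For every such factorization $C=FF^\top$, $$z_\Gamma(C,s;F)\ \le\ \sum_{\ell=1}^{s}\log\delta_\ell(C),$$ that is, the factorization bound for $\mathrm{MESP}(C,s)$ is at most the diagonal bound. -/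

import Mathlib

namespace MESP

/-- The natural logarithm on `[0, ∞)` with values in the extended reals, so that `log 0 = -∞`. -/
noncomputable def elog (x : ℝ) : EReal := ENNReal.log (ENNReal.ofReal x)

/-- `∑_{ℓ = i+1}^{k} ω_ℓ` for a vector `ω = (ω_1, …, ω_k)`;
the entry `ω_ℓ` of the 1-based notation is `ω ⟨ℓ - 1, _⟩`. -/
noncomputable def tailSum {k : ℕ} (ω : Fin k → ℝ) (i : ℕ) : ℝ :=
  ∑ ℓ : Fin k with i ≤ ℓ.val, ω ℓ

/-- The index condition `0 ≤ i < s` and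
`ω_i > (1 / (s - i)) ∑_{ℓ = i+1}^{k} ω_ℓ ≥ ω_{i+1}` (1-based), where `ω_0 = +∞`, so that the first
inequality is void for `i = 0`. -/
def IsSplitIndex {k : ℕ} (s : ℕ) (ω : Fin k → ℝ) (i : ℕ) : Prop :=
  i < s ∧
  (∀ j : Fin k, j.val + 1 = i → tailSum ω i / ((s : ℝ) - i) < ω j) ∧
  (∀ j : Fin k, j.val = i → ω j ≤ tailSum ω i / ((s : ℝ) - i))

theorem tailSum_eq_add {k : ℕ} (ω : Fin k → ℝ) (j : Fin k) :
    tailSum ω j.val = ω j + tailSum ω (j.val + 1) := by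
  classical
  unfold tailSum
  have h : (Finset.univ.filter fun ℓ : Fin k => j.val ≤ ℓ.val)
      = insert j (Finset.univ.filter fun ℓ : Fin k => j.val + 1 ≤ ℓ.val) := by
    ext ℓ
    simp only [Finset.mem_filter, Finset.mem_univ, true_and, Finset.mem_insert, Fin.ext_iff]
    omega
  rw [h, Finset.sum_insert (by simp)]

/-- The defining index of the function `φ_s` exists and is unique. -/
theorem existsUnique_isSplitIndex {k s : ℕ} (hs : 0 < s) (hsk : s ≤ k) (ω : Fin k → ℝ)
    (h0 : ∀ j, 0 ≤ ω j) (hω : Antitone ω) : ∃! i, IsSplitIndex s ω i := by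
  classical
  -- `B i` is the right-hand inequality; it propagates upwards and negates the left-hand one.
  let B : ℕ → Prop := fun i => i < s ∧ ∀ j : Fin k, j.val = i → ((s : ℝ) - i) * ω j ≤ tailSum ω i
  have hpos : ∀ i : ℕ, i < s → 0 < (s : ℝ) - i := fun i hi => by
    have : (i : ℝ) < s := by exact_mod_cast hi
    linarith
  have hB : ∀ i, IsSplitIndex s ω i → B i := fun i h => ⟨h.1, fun j hj => by
    have := h.2.2 j hj
    rw [le_div_iff₀ (hpos i h.1)] at this
    linarith⟩
  have hstep : ∀ i, i + 1 < s → B i → B (i + 1) := by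
    intro i hi h
    refine ⟨hi, fun j hj => ?_⟩
    have h1 := h.2 ⟨i, by omega⟩ rfl
    have h2 := tailSum_eq_add ω ⟨i, by omega⟩
    have h3 : ω j ≤ ω ⟨i, by omega⟩ := hω (by rw [Fin.le_def]; simp only []; omega)
    have h4 := hpos (i + 1) hi
    push_cast at h4 ⊢
    simp only [] at h2
    nlinarith [mul_le_mul_of_nonneg_left h3 h4.le]
  have hmono : ∀ i m, i ≤ m → m < s → B i → B m := by
    intro i m him
    induction m, him using Nat.le_induction with
    | base => exact fun _ h => h
    | succ m _ ih => exact fun hm h => hstep m hm (ih (by omega) h)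
  have hneg : ∀ i, i + 1 < s → B i → ¬ IsSplitIndex s ω (i + 1) := by
    intro i hi h h'
    have h1 := h.2 ⟨i, by omega⟩ rfl
    have h2 := tailSum_eq_add ω ⟨i, by omega⟩
    have h3 := h'.2.1 ⟨i, by omega⟩ rfl
    rw [div_lt_iff₀ (hpos _ hi)] at h3
    push_cast at h3
    simp only [] at h2
    nlinarith
  have hex : ∃ i, B i := by
    refine ⟨s - 1, by omega, fun j hj => ?_⟩
    have h2 := tailSum_eq_add ω j
    have h3 : 0 ≤ tailSum ω (j.val + 1) := Finset.sum_nonneg fun ℓ _ => h0 ℓ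
    have h4 : ((s : ℝ) - ((s - 1 : ℕ) : ℝ)) = 1 := by
      rw [Nat.cast_sub (by omega)]; push_cast; ring
    rw [h4, ← hj]
    linarith
  refine ⟨Nat.find hex, ⟨(Nat.find_spec hex).1, fun j hj => ?_, fun j hj => ?_⟩, fun m hm => ?_⟩
  · have hlt := (Nat.find_spec hex).1
    have hnot := Nat.find_min hex (m := j.val) (by omega)
    rw [div_lt_iff₀ (hpos _ hlt)]
    by_contra hcon
    refine hnot ⟨by omega, fun j' hj' => ?_⟩
    obtain rfl : j' = j := Fin.ext hj'
    have h2 := tailSum_eq_add ω j'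
    rw [hj] at h2
    have h5 : ((Nat.find hex : ℕ) : ℝ) = (j'.val : ℝ) + 1 := by rw [← hj]; push_cast; rfl
    rw [h5] at hcon
    nlinarith
  · rw [le_div_iff₀ (hpos _ (Nat.find_spec hex).1)]
    have := (Nat.find_spec hex).2 j hj
    linarith
  · by_contra hne
    have hge : Nat.find hex ≤ m := Nat.find_min' hex (hB m hm)
    obtain ⟨m, rfl⟩ : ∃ m', m = m' + 1 := ⟨m - 1, by omega⟩
    exact hneg m hm.1
      (hmono _ m (by omega) (by have := hm.1; omega) (Nat.find_spec hex)) hm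

/-- The index `î` of a nonincreasing nonnegative vector: the unique index with `IsSplitIndex`
(see `existsUnique_isSplitIndex`). -/
noncomputable def splitIndex {k : ℕ} (s : ℕ) (ω : Fin k → ℝ) : ℕ := sInf {i | IsSplitIndex s ω i}

/-- `φ_s(ω) = ∑_{ℓ=1}^{î} log ω_ℓ + (s - î) log ((1 / (s - î)) ∑_{ℓ=î+1}^{k} ω_ℓ)`, for
`ω_1 ≥ … ≥ ω_k ≥ 0` and `0 < s ≤ k`. -/
noncomputable def phi {k : ℕ} (s : ℕ) (ω : Fin k → ℝ) : EReal :=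
  (∑ ℓ : Fin k with ℓ.val < splitIndex s ω, elog (ω ℓ)) +
    (s - splitIndex s ω) • elog (tailSum ω (splitIndex s ω) / ((s : ℝ) - splitIndex s ω))

/-- The `Γ`-function `Γ_s(X) = φ_s(λ(X))`; here `hX.eigenvalues₀` is the vector of the eigenvalues
of `X` with multiplicity, in nonincreasing order. -/
noncomputable def Gam {p : ℕ} (s : ℕ) (X : Matrix (Fin p) (Fin p) ℝ) (hX : X.IsHermitian) : EReal :=
  phi s hX.eigenvalues₀

theorem isHermitian_weighted {n p : ℕ} (F : Matrix (Fin n) (Fin p) ℝ) (x : Fin n → ℝ) :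
    (F.transpose * Matrix.diagonal x * F).IsHermitian := by
  rw [Matrix.IsHermitian, Matrix.conjTranspose_eq_transpose_of_trivial]
  simp [Matrix.transpose_mul, Matrix.mul_assoc]

/-- The factorization bound (the optimal value of DDFact) for `C = F Fᵀ`:
the maximum of `Γ_s(Fᵀ Diag(x) F)` over `x ∈ [0,1]^n` with `∑ i, x_i = s`. -/
noncomputable def factorizationBound {n p : ℕ} (F : Matrix (Fin n) (Fin p) ℝ) (s : ℕ) : EReal :=
  ⨆ x ∈ {x : Fin n → ℝ | (∀ i, 0 ≤ x i ∧ x i ≤ 1) ∧ ∑ i, x i = s},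
    Gam s (F.transpose * Matrix.diagonal x * F) (isHermitian_weighted F x)

/-- `δ(X)`: the diagonal entries of `X`, with multiplicity, in nonincreasing order. -/
noncomputable def sortedDiag {n : ℕ} (X : Matrix (Fin n) (Fin n) ℝ) (i : Fin n) : ℝ :=
  X.diag (Tuple.sort X.diag i.rev)

theorem antitone_sortedDiag {n : ℕ} (X : Matrix (Fin n) (Fin n) ℝ) : Antitone (sortedDiag X) :=
  fun _ _ h => Tuple.monotone_sort X.diag (Fin.rev_le_rev.mpr h)

/-- The diagonal bound `∑_{ℓ=1}^{s} log δ_ℓ(C)`. -/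
noncomputable def diagonalBound {n : ℕ} (C : Matrix (Fin n) (Fin n) ℝ) (s : ℕ) : EReal :=
  ∑ ℓ : Fin n with ℓ.val < s, elog (sortedDiag C ℓ)

end MESP

namespace MESP

open Matrix

/-! Fix a feasible `x` and rotate `Diag(√x) F` by an orthogonal matrix into `G` with `Gᵀ G =
Diag(ω)`, `ω` the eigenvalues of `Fᵀ Diag(x) F`; row `i` of `G` has squared norm `x_i C_ii`. If
`φ_s(ω)` is finite, it equals `∑ (ω_l / b_l) log b_l` with `b ≥ ω`. Spread it over the array `G_il²
/ b_l`, whose column sums are `ω_l / b_l`, whose row sums `t_i` are at most 1 and whose total is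
`s`.

The tangent inequality `log b_l ≤ b_l / m_i - 1 + log m_i` with `m_i = max(C_ii, δ_s)` trades
eigenvalues for diagonal entries. The error is at most `∑ x_i - ∑ t_i = s - s = 0`, leaving `∑ t_i
log m_i`, a linear program in `t` whose value is at most the diagonal bound. -/

theorem elog_of_pos {x : ℝ} (hx : 0 < x) : elog x = (Real.log x : EReal) :=
  ENNReal.log_ofReal_of_pos hx

theorem elog_zero : elog 0 = ⊥ := by simp [elog]

theorem sum_elog_of_pos {ι : Type*} (t : Finset ι) (f : ι → ℝ) (hf : ∀ i ∈ t, 0 < f i) :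
    ∑ i ∈ t, elog (f i) = ((∑ i ∈ t, Real.log (f i) : ℝ) : EReal) := by
  classical
  induction t using Finset.induction_on with
  | empty => simp
  | insert a t ha ih =>
    rw [Finset.sum_insert ha, Finset.sum_insert ha, EReal.coe_add,
      elog_of_pos (hf a (Finset.mem_insert_self a t)),
      ih fun i hi => hf i (Finset.mem_insert_of_mem hi)]

theorem isSplitIndex_splitIndex {k s : ℕ} (hs : 0 < s) (hsk : s ≤ k) (ω : Fin k → ℝ)
    (h0 : ∀ j, 0 ≤ ω j) (hω : Antitone ω) : IsSplitIndex s ω (splitIndex s ω) :=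
  Nat.sInf_mem (existsUnique_isSplitIndex hs hsk ω h0 hω).exists

/-- `φ_s(ω)` is either `-∞` or a weighted sum of logarithms: the vector `b` replaces the entries of
`ω` after the split index by their total divided by `s - î`, and the weights `ω_ℓ / b_ℓ ∈ [0, 1]`
add up to `s`. -/
theorem phi_eq_bot_or_exists {k s : ℕ} (hs : 0 < s) (hsk : s ≤ k) (ω : Fin k → ℝ)
    (h0 : ∀ j, 0 ≤ ω j) (hω : Antitone ω) :
    phi s ω = ⊥ ∨ ∃ b : Fin k → ℝ, (∀ l, 0 < b l) ∧ (∀ l, ω l ≤ b l) ∧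
      ∑ l, ω l / b l = s ∧ phi s ω = ((∑ l, ω l / b l * Real.log (b l) : ℝ) : EReal) := by
  obtain ⟨his, hleft, hright⟩ := isSplitIndex_splitIndex hs hsk ω h0 hω
  unfold phi
  generalize splitIndex s ω = i at *
  have hpos : 0 < (s : ℝ) - i := sub_pos.2 (by exact_mod_cast his)
  set m := tailSum ω i / ((s : ℝ) - i) with hm
  have htail : tailSum ω i = ((s : ℝ) - i) * m := by rw [hm]; field_simp
  have hm0 : 0 ≤ m := div_nonneg (Finset.sum_nonneg fun l _ => h0 l) hpos.le
  rcases hm0.eq_or_lt with hm0 | hm0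
  · left
    rw [← hm0, elog_zero]
    -- The multiplicity has to be positive: `0 • ⊥` would be `0`.
    obtain ⟨d, hd⟩ : ∃ d, s - i = d + 1 := ⟨s - i - 1, by omega⟩
    rw [hd, succ_nsmul, EReal.add_bot, EReal.add_bot]
  · right
    have hlt : ∀ l : Fin k, l.val < i → m < ω l := fun l hl =>
      (hleft ⟨i - 1, by omega⟩ (by simp only []; omega)).trans_le
        (hω (by rw [Fin.le_def]; simp only []; omega))
    have hge : ∀ l : Fin k, ¬ l.val < i → ω l ≤ m := fun l hl =>
      (hω (by rw [Fin.le_def]; simp only []; omega)).trans (hright ⟨i, by omega⟩ rfl)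
    have htail' : ∑ l : Fin k with ¬ l.val < i, ω l = ((s : ℝ) - i) * m := by
      rw [← htail, tailSum]; simp only [not_lt]
    have hcard : (Finset.univ.filter fun l : Fin k => l.val < i).card = i := by
      rw [Fin.card_filter_val_lt]; omega
    have hsum : ∑ l : Fin k with ¬ l.val < i, ω l / m = (s : ℝ) - i := by
      rw [← Finset.sum_div, htail', mul_div_cancel_right₀ _ hm0.ne']
    -- The `i` head entries get weight 1 each; the tail entries get `ω l / m`, in total `s - i`.
    refine ⟨fun l => if l.val < i then ω l else m, fun l => ?_, fun l => ?_, ?_, ?_⟩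
    · dsimp only
      split_ifs with hl
      exacts [hm0.trans (hlt l hl), hm0]
    · dsimp only
      split_ifs with hl
      exacts [le_rfl, hge l hl]
    · rw [← Finset.sum_filter_add_sum_filter_not _ (fun l : Fin k => l.val < i)]
      have h1 : ∑ l : Fin k with l.val < i, ω l / (if l.val < i then ω l else m) = i := by
        rw [Finset.sum_congr rfl (g := fun _ => (1 : ℝ))]
        · simp [hcard]
        · intro l hl
          have hl := (Finset.mem_filter.1 hl).2
          rw [if_pos hl, div_self (hm0.trans (hlt l hl)).ne']
      have h2 : ∑ l : Fin k with ¬ l.val < i, ω l / (if l.val < i then ω l else m)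
          = (s : ℝ) - i := by
        rw [← hsum]
        exact Finset.sum_congr rfl fun l hl => by rw [if_neg (Finset.mem_filter.1 hl).2]
      rw [h1, h2]; ring
    · rw [sum_elog_of_pos _ _ fun l hl => hm0.trans (hlt l (Finset.mem_filter.1 hl).2),
        elog_of_pos hm0, ← EReal.coe_nsmul, ← EReal.coe_add, EReal.coe_eq_coe_iff,
        ← Finset.sum_filter_add_sum_filter_not Finset.univ (fun l : Fin k => l.val < i)
          fun l => ω l / (if l.val < i then ω l else m) *
            Real.log (if l.val < i then ω l else m)]
      congr 1
      · refine Finset.sum_congr rfl fun l hl => ?_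
        have hl := (Finset.mem_filter.1 hl).2
        rw [if_pos hl, div_self (hm0.trans (hlt l hl)).ne', one_mul]
      · rw [nsmul_eq_mul, Nat.cast_sub his.le, ← hsum, Finset.sum_mul]
        exact Finset.sum_congr rfl fun l hl => by rw [if_neg (Finset.mem_filter.1 hl).2]

/-- If `b` dominates the diagonal matrix `Gᵀ G`, then the diagonal entries of
`G Diag(b)⁻¹ Gᵀ` are at most `1`. -/
theorem sum_sq_div_le_one {n k : Type*} [Fintype n] [Fintype k] [DecidableEq k]
    (G : Matrix n k ℝ) (ω b : k → ℝ) (hG : Gᵀ * G = diagonal ω) (hb : ∀ l, 0 < b l)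
    (hωb : ∀ l, ω l ≤ b l) (i : n) : ∑ l, G i l ^ 2 / b l ≤ 1 := by
  set t := ∑ l, G i l ^ 2 / b l with ht
  -- Test vector `Diag(b)⁻¹` times row `i` of `G`: entry `i` of `G u` is `t`, while `‖G u‖² = ∑ ω u²
  -- ≤ t`. Hence `t² ≤ t`.
  set u : k → ℝ := fun l => G i l / b l with hu
  have h1 : (G *ᵥ u) i = t := by
    simp only [mulVec, dotProduct, hu, ht]
    exact Finset.sum_congr rfl fun l _ => by ring
  have h2 : (G *ᵥ u) ⬝ᵥ (G *ᵥ u) = ∑ l, ω l * u l ^ 2 := by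
    rw [dotProduct_mulVec, ← mulVec_transpose, mulVec_mulVec, hG]
    simp only [dotProduct, mulVec_diagonal]
    exact Finset.sum_congr rfl fun l _ => by ring
  have h3 : t ^ 2 ≤ (G *ᵥ u) ⬝ᵥ (G *ᵥ u) := by
    rw [← h1, sq]
    exact Finset.single_le_sum (f := fun j => (G *ᵥ u) j * (G *ᵥ u) j)
      (fun j _ => mul_self_nonneg _) (Finset.mem_univ i)
  have h4 : ∑ l, ω l * u l ^ 2 ≤ t := by
    refine Finset.sum_le_sum fun l _ => ?_
    calc ω l * u l ^ 2 ≤ b l * u l ^ 2 := mul_le_mul_of_nonneg_right (hωb l) (sq_nonneg _)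
      _ = G i l ^ 2 / b l := by
        have := (hb l).ne'
        simp only [hu]
        field_simp
  nlinarith

/-- Diagonalization of `Aᵀ A` by multiplying `A` from the right with an orthogonal matrix. -/
theorem exists_transpose_mul_self_eq_diagonal {n p : ℕ} (A : Matrix (Fin n) (Fin p) ℝ)
    {X : Matrix (Fin p) (Fin p) ℝ} (hX : X.IsHermitian) (hAX : X = Aᵀ * A) :
    ∃ G : Matrix (Fin n) (Fin (Fintype.card (Fin p))) ℝ,
      Gᵀ * G = diagonal hX.eigenvalues₀ ∧ G * Gᵀ = A * Aᵀ := by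
  set U : Matrix (Fin p) (Fin p) ℝ := (hX.eigenvectorUnitary).val
  -- The same equivalence by which `eigenvalues` reindexes `eigenvalues₀`, so the columns come out
  -- in sorted order.
  set e := (Fintype.equivOfCardEq (Fintype.card_fin (Fintype.card (Fin p))) :
    Fin (Fintype.card (Fin p)) ≃ Fin p)
  have hst : star U = Uᵀ := by
    rw [star_eq_conjTranspose, conjTranspose_eq_transpose_of_trivial]
  have hU : U * Uᵀ = 1 := by
    rw [← hst]; exact Unitary.coe_mul_star_self hX.eigenvectorUnitary
  have hD : Uᵀ * X * U = diagonal hX.eigenvalues := by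
    have h := hX.conjStarAlgAut_star_eigenvectorUnitary
    rw [Unitary.conjStarAlgAut_star_apply] at h
    rw [← hst]
    exact h
  refine ⟨(A * U).submatrix id e, ?_, ?_⟩
  · rw [transpose_submatrix, ← submatrix_mul _ _ e id e Function.bijective_id, transpose_mul,
      Matrix.mul_assoc, ← Matrix.mul_assoc Aᵀ, ← hAX, ← Matrix.mul_assoc, hD,
      submatrix_diagonal_equiv]
    congr 1
    ext l
    simp [IsHermitian.eigenvalues, e]
  · rw [transpose_submatrix, submatrix_mul_equiv _ _ id e id, transpose_mul, Matrix.mul_assoc,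
      ← Matrix.mul_assoc U, hU, Matrix.one_mul, submatrix_id_id]

/-- The linear program `max {∑ t_i log c_i : ∑ t_i = s, 0 ≤ t ≤ 1}` is solved by the `s` greatest
entries of `c`; here `c` is nonincreasing, and is capped from below at `c_s`. -/
theorem sum_mul_log_max_le {n : ℕ} (c t : Fin n → ℝ) (hc : Antitone c) (r : Fin n)
    (hr : 0 < c r) (ht1 : ∀ i, t i ≤ 1) (hts : ∑ i, t i = (r.val : ℝ) + 1) :
    ∑ i, t i * Real.log (max (c i) (c r)) ≤ ∑ i : Fin n with i.val < r.val + 1, Real.log (c i) := by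
  have hcard : (Finset.univ.filter fun l : Fin n => l.val < r.val + 1).card = r.val + 1 := by
    rw [Fin.card_filter_val_lt]; omega
  -- After subtracting `log c_r`, the first `r + 1` terms have nonnegative coefficients and the
  -- others vanish. Since `t` sums to `r + 1`, the subtracted constants agree on both sides.
  have key : ∑ i, t i * (Real.log (max (c i) (c r)) - Real.log (c r))
      ≤ ∑ i : Fin n with i.val < r.val + 1, (Real.log (c i) - Real.log (c r)) := by
    rw [Finset.sum_filter]
    refine Finset.sum_le_sum fun i _ => ?_
    split_ifs with hi
    · have hci : c r ≤ c i := hc (by rw [Fin.le_def]; omega)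
      rw [max_eq_left hci]
      exact mul_le_of_le_one_left (sub_nonneg.2 (Real.log_le_log hr hci)) (ht1 i)
    · rw [max_eq_right (hc (by rw [Fin.le_def]; omega)), sub_self, mul_zero]
  simp only [mul_sub, Finset.sum_sub_distrib, ← Finset.sum_mul, hts, Finset.sum_const, hcard,
    nsmul_eq_mul, Nat.cast_add, Nat.cast_one] at key
  linarith

/-- The core estimate. Only `G` enters, through its column Gram matrix and its row norms; the factor
`F` no longer appears. -/
theorem phi_le_diagonalBound {n k s : ℕ} (hs : 0 < s) (hsn : s < n) (hsk : s ≤ k)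
    (C : Matrix (Fin n) (Fin n) ℝ) (hC : ∀ i, 0 ≤ C i i) (x : Fin n → ℝ)
    (hx : ∀ i, 0 ≤ x i ∧ x i ≤ 1) (hxs : ∑ i, x i = s) (G : Matrix (Fin n) (Fin k) ℝ)
    (ω : Fin k → ℝ) (hω : Antitone ω) (hG : Gᵀ * G = diagonal ω)
    (hGC : ∀ i, (G * Gᵀ) i i = x i * C i i) : phi s ω ≤ diagonalBound C s := by
  have hcol : ∀ l, ∑ i, G i l ^ 2 = ω l := fun l => by
    have := congrFun (congrFun hG l) l
    simpa [mul_apply, sq] using this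
  have hrow : ∀ i, ∑ l, G i l ^ 2 = x i * C i i := fun i => by
    rw [← hGC i]; simp [mul_apply, sq]
  have h0 : ∀ l, 0 ≤ ω l := fun l => hcol l ▸ Finset.sum_nonneg fun i _ => sq_nonneg _
  obtain hbot | ⟨b, hb, hωb, hbs, hphi⟩ := phi_eq_bot_or_exists hs hsk ω h0 hω
  · rw [hbot]; exact bot_le
  set t : Fin n → ℝ := fun i => ∑ l, G i l ^ 2 / b l with ht
  have ht1 : ∀ i, t i ≤ 1 := sum_sq_div_le_one G ω b hG hb hωb
  have hts : ∑ i, t i = s := by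
    rw [← hbs, ht, Finset.sum_comm]
    exact Finset.sum_congr rfl fun l _ => by rw [← Finset.sum_div, hcol]
  set σ : Equiv.Perm (Fin n) := Fin.revPerm.trans (Tuple.sort C.diag) with hσ
  have hδ : ∀ i, sortedDiag C i = C (σ i) (σ i) := fun i => rfl
  have hanti := antitone_sortedDiag C
  set r : Fin n := ⟨s - 1, by omega⟩ with hr
  have hrs : r.val + 1 = s := by simp only [hr]; omega
  have hrs' : (r.val : ℝ) + 1 = s := by exact_mod_cast hrs
  -- Fewer than `s` positive diagonal entries would leave no room for the weights `t`.
  have hrpos : 0 < sortedDiag C r := by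
    by_contra hneg
    have hz : ∀ i : Fin n, ¬ i.val < r.val → t (σ i) = 0 := fun i hi => by
      have hCi : C (σ i) (σ i) = 0 :=
        le_antisymm (((hanti (Fin.le_def.2 (not_lt.1 hi))).trans (not_lt.1 hneg))) (hC _)
      have h := hrow (σ i)
      rw [hCi, mul_zero, Finset.sum_eq_zero_iff_of_nonneg fun l _ => sq_nonneg _] at h
      exact Finset.sum_eq_zero fun l hl => by rw [h l hl, zero_div]
    have hle : ∑ i, t (σ i) ≤ ∑ i : Fin n with i.val < r.val, (1 : ℝ) := by
      rw [Finset.sum_filter]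
      refine Finset.sum_le_sum fun i _ => ?_
      split_ifs with hi
      exacts [ht1 _, (hz i hi).le]
    rw [Equiv.sum_comp σ t, hts, Finset.sum_const, Fin.card_filter_val_lt, nsmul_eq_mul, mul_one,
      min_eq_right r.isLt.le] at hle
    linarith
  -- Diagonal entries may vanish; the cap at `δ_s > 0` makes division and logarithm safe.
  set m : Fin n → ℝ := fun i => max (C i i) (sortedDiag C r) with hm
  have hmpos : ∀ i, 0 < m i := fun i => hrpos.trans_le (le_max_right _ _)
  have hlp : ∑ i, t i * Real.log (m i)
      ≤ ∑ i : Fin n with i.val < s, Real.log (sortedDiag C i) := by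
    have h := sum_mul_log_max_le (sortedDiag C) (fun i => t (σ i)) hanti r hrpos
      (fun i => ht1 _) (by rw [Equiv.sum_comp σ t, hts, hrs'])
    rw [hrs] at h
    rw [← Equiv.sum_comp σ]
    exact h
  have hlog : ∀ i l, Real.log (b l) ≤ b l / m i - 1 + Real.log (m i) := fun i l => by
    have h := Real.log_le_sub_one_of_pos (div_pos (hb l) (hmpos i))
    rw [Real.log_div (hb l).ne' (hmpos i).ne'] at h
    linarith
  have hbound : ∑ l, ω l / b l * Real.log (b l) ≤ ∑ i, t i * Real.log (m i) := by
    calc ∑ l, ω l / b l * Real.log (b l)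
        = ∑ l, ∑ i, G i l ^ 2 / b l * Real.log (b l) :=
          Finset.sum_congr rfl fun l _ => by rw [← hcol, Finset.sum_div, Finset.sum_mul]
      _ ≤ ∑ l, ∑ i, G i l ^ 2 / b l * (b l / m i - 1 + Real.log (m i)) :=
          Finset.sum_le_sum fun l _ => Finset.sum_le_sum fun i _ =>
            mul_le_mul_of_nonneg_left (hlog i l) (div_nonneg (sq_nonneg _) (hb l).le)
      _ = ∑ i, ∑ l, (G i l ^ 2 / m i + G i l ^ 2 / b l * (Real.log (m i) - 1)) := by
          rw [Finset.sum_comm]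
          refine Finset.sum_congr rfl fun i _ => Finset.sum_congr rfl fun l _ => ?_
          have := (hb l).ne'
          have := (hmpos i).ne'
          field_simp
          ring
      _ = ∑ i, (x i * (C i i / m i) + (t i * Real.log (m i) - t i)) := by
          refine Finset.sum_congr rfl fun i _ => ?_
          rw [Finset.sum_add_distrib, ← Finset.sum_div, hrow, ← Finset.sum_mul]
          ring
      _ ≤ ∑ i, (x i + (t i * Real.log (m i) - t i)) := by
          refine Finset.sum_le_sum fun i _ => add_le_add_left ?_ _
          exact mul_le_of_le_one_right (hx i).1 ((div_le_one (hmpos i)).2 (le_max_left _ _))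
      _ = ∑ i, t i * Real.log (m i) := by
          rw [Finset.sum_add_distrib, Finset.sum_sub_distrib, hxs, hts]; ring
  rw [hphi, diagonalBound, sum_elog_of_pos _ _ fun i hi => hrpos.trans_le
    (hanti (by rw [Fin.le_def]; have := (Finset.mem_filter.1 hi).2; omega)), EReal.coe_le_coe_iff]
  exact hbound.trans hlp

end MESP

theorem mainTheorem5 (n s : ℕ) (hs : 0 < s) (hsn : s < n)
    (C : Matrix (Fin n) (Fin n) ℝ) (hC : C.PosSemidef) (hrank : s ≤ C.rank)
    (p : ℕ) (hp : p ≤ n) (F : Matrix (Fin n) (Fin p) ℝ) (hF : C = F * F.transpose) :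
    MESP.factorizationBound F s ≤ MESP.diagonalBound C s := by
  have hsp : s ≤ p := by
    rw [hF] at hrank
    exact hrank.trans ((Matrix.rank_mul_le_left _ _).trans F.rank_le_width)
  refine iSup₂_le fun x hx => ?_
  have hsq : ∀ i, √(x i) * √(x i) = x i := fun i => Real.mul_self_sqrt (hx.1 i).1
  -- Splitting `Diag(x)` as `D * D` makes the weighted matrix a Gram matrix, and `(D F)(D F)ᵀ = D C
  -- D` has diagonal `x_i C_ii`.
  set D : Matrix (Fin n) (Fin n) ℝ := Matrix.diagonal fun i => √(x i) with hD
  obtain ⟨G, hG, hGA⟩ := MESP.exists_transpose_mul_self_eq_diagonal (D * F)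
    (MESP.isHermitian_weighted F x) (by
      rw [Matrix.transpose_mul, Matrix.mul_assoc F.transpose D.transpose,
        ← Matrix.mul_assoc D.transpose, hD, Matrix.diagonal_transpose,
        Matrix.diagonal_mul_diagonal, ← Matrix.mul_assoc]
      simp only [hsq])
  refine MESP.phi_le_diagonalBound hs hsn (by rwa [Fintype.card_fin]) C
    (fun i => hC.diag_nonneg) x hx.1 hx.2 G _
    (MESP.isHermitian_weighted F x).eigenvalues₀_antitone hG fun i => ?_
  rw [hGA, Matrix.transpose_mul, Matrix.mul_assoc, ← Matrix.mul_assoc F, ← hF, hD,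
    Matrix.diagonal_transpose, Matrix.diagonal_mul, Matrix.mul_diagonal, ← hsq i]
  simp only [hsq]
  rw [mul_comm (C i i), ← mul_assoc, hsq]
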